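/- Let $A$ be a set (of urelements), and let $V(A)=\bigcup_n V_n(A)$ be its superstructure, where $V_0(A)=A$ and $V_{n+1}(A)=V_n(A)\cup\mathcal P(V_n(A))$. Let $\rho$ be an ultrafilter on a set $I$, and for a set $X$ let ${}^*X=X^I/\rho$ be its ultrapower, where $x\in X$ has the constant class ${}^*x\in{}^*X$ as its transform. A subset of ${}^*X$ is internal if it is of the form $\{[x] : x_i\in S_i \text{ for } \rho\text{-almost every } i\}$ with $S_i\subseteq X$, and it is hyperfinite if moreover $S_i$ is finite for $\rho$-almost every $i$. Assume that the concurrency principle holds for internal relations over $V(A)$: if $X,Y\in V(A)$ are sets and $r\subseteq{}^*X\times{}^*Y$ is an internal relation such that for each finite $C\subseteq X$ there is $b\in{}^*Y$ with ${}^*x\mathrel r b$ for all $x\in C$, then there is $b\in{}^*Y$ with ${}^*x\mathrel r b$ for all $x\in X$. Let $\mathbb A=(A,\mathcal O)$ be an algebra with arbitrarily many operations of arbitrary, finite or infinite, arities. The operations ${}^*\mathcal O$ of ${}^*\mathbb A$ are the internal operations $[o_i]$ with $o_i\in\mathcal O$, applied to internal tuples $[x_i]$ by $[o_i]([x_i])=[o_i(x_i)]$,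 where $x_i$ is a tuple of elements of $A$ indexed by the arity of $o_i$. A subalgebra $\mathbb B\le{}^*\mathbb A$ is a (possibly external, possibly empty) set $B\subseteq{}^*A$ that contains the value of every operation of ${}^*\mathcal O$ at every internal tuple with all entries in $B$. We say that $\mathbb A$ is a subreduct of $\mathbb B$ if, along $a\mapsto{}^*a$, $A$ is contained in $B$ and each operation $f\in\mathcal O$ is the restriction of ${}^*f$, that is, ${}^*f({}^*x)={}^*(f(x))$. For $X\subseteq{}^*A$ let $\langle X\rangle$ be the intersection of all subalgebras of ${}^*\mathbb A$ that contain $X$, and let $\langle X\rangle^{(int)}$ be the intersection of all internal subalgebras of ${}^*\mathbb A$ that contain $X$. A subalgebra is hyperfinitely generated if it equals $\langle F\rangle^{(int)}$ for a hyperfinite $F\subseteq{}^*A$. For $F\subseteq A$, $\langle F\rangle^{(int)}$ means $\langle\{{}^*a : a\in F\}\rangle^{(int)}$. The extension monad of $\mathbb A$ is $$\hat{\mathbb A}=\bigcap\{\mathbb B\le{}^*\mathbb A : \mathbb B\text{ is internal and }\mathbb A\text{ is a subreduct of }\mathbb B\}.$$ **Theorem.** The extension monad satisfies $$\begin{aligned}\hat{\mathbb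 A}&=\bigcap\{\mathbb B\le{}^*\mathbb A : \mathbb B\text{ is internal and hyperfinitely generated, and }\mathbb A\text{ is a subreduct of }\mathbb B\}\\&=\Big\langle\bigcup\{\langle F\rangle^{(int)} : F\subseteq A\text{ is finite}\}\Big\rangle\\&=\bigcup\{\langle F\rangle^{(int)} : F\subseteq\hat{\mathbb A}\text{ is hyperfinite}\}.\end{aligned}$$ -/

import Mathlib

universe u v w t

namespace Nonstandard

/-- The levels of the superstructure over a set `U` of urelements:
`V₀(U) = U` and `Vₙ₊₁(U) = U ∪ 𝒫(Vₙ(U))` (which is the same as `Vₙ(U) ∪ 𝒫(Vₙ(U))`). -/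
def SuperLevel (U : Type u) : ℕ → Type u
  | 0 => U
  | n + 1 => U ⊕ Set (SuperLevel U n)

section Ultrapower

variable {I : Type t} (ρ : Ultrafilter I)

/-- `*X`: the ultrapower of the set `X`.  The transform of a point `a` is the constant germ `↑a`. -/
abbrev Star (X : Type u) : Type (max t u) := Filter.Germ (ρ : Filter I) X

variable {ρ}

/-- The set of members of `S ∈ *𝒫(X)`, where membership is membership modulo the ultrafilter:
`[x] ∈ [S]` iff `xᵢ ∈ Sᵢ` for `ρ`-almost every `i`.  (This is the Mostowski collapse of `S`.) -/
def members {X : Type u} (S : Star ρ (Set X)) : Set (Star ρ X) :=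
  {x | Filter.Germ.LiftRel (fun (a : X) (T : Set X) => a ∈ T) x S}

/-- A subset of `*X` is internal if it is an element of `*𝒫(X)`. -/
def IsInternal {X : Type u} (B : Set (Star ρ X)) : Prop :=
  ∃ S : Star ρ (Set X), B = members S

/-- A subset of `*X` is hyperfinite if it is an element of the transform of the collection of
finite subsets of `X`. -/
def IsHyperfinite {X : Type u} (F : Set (Star ρ X)) : Prop :=
  ∃ S : Star ρ (Set X), Filter.Germ.LiftPred Set.Finite S ∧ F = members S

variable (ρ)

/-- The concurrency principle over the superstructure `V(U)`, for internal relations.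
Let `X, Y ∈ V(U)` be sets and let `r ⊆ *X × *Y` be an internal relation.  If for every finite
`C ⊆ X` there is `b ∈ *Y` with `*x r b` for all `x ∈ C`, then there is `b ∈ *Y` with `*x r b`
for all `x ∈ X`.  Here `b.map (Prod.mk x)` is the pair `(*x, b)`, an element of `*(X × Y)`. -/
def InternalConcurrency (U : Type u) : Prop :=
  ∀ (m n : ℕ) (X : Set (SuperLevel U m)) (Y : Set (SuperLevel U n))
    (r : Star ρ (Set (X × Y))),
    (∀ C : Set X, C.Finite → ∃ b : Star ρ Y, ∀ x ∈ C, b.map (Prod.mk x) ∈ members r) →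
      ∃ b : Star ρ Y, ∀ x : X, b.map (Prod.mk x) ∈ members r

end Ultrapower

/-- An algebra with underlying set `A`: an arbitrary indexed collection of operations, each of an
arbitrary (finite or infinite) arity. -/
structure Algebra (A : Type u) where
  /-- the index set of the operations -/
  Op : Type v
  /-- the index set of the arguments of an operation -/
  arity : Op → Type w
  /-- the operations -/
  op : ∀ o : Op, (arity o → A) → A

namespace Algebra

variable {I : Type t} {ρ : Ultrafilter I} {A : Type u} (𝔸 : Algebra.{u, v, w} A)

/-- The value of the internal operation `[o] ∈ *𝒪` of `*𝔸` at the internal tuple `[x]`, where `xᵢ`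
is a tuple of elements of `A` indexed by the arity of `oᵢ`. -/
def starOp (ρ : Ultrafilter I) (o : I → 𝔸.Op) (x : ∀ i, 𝔸.arity (o i) → A) : Star ρ A :=
  ((fun i => 𝔸.op (o i) (x i) : I → A) : Star ρ A)

/-- The set of entries of the internal tuple `[x]`: the internal set `[range xᵢ]`. -/
def entries (ρ : Ultrafilter I) {o : I → 𝔸.Op} (x : ∀ i, 𝔸.arity (o i) → A) : Set (Star ρ A) :=
  members ((fun i => Set.range (x i) : I → Set A) : Star ρ (Set A))

/-- `B ≤ *𝔸`: the (internal or external) set `B ⊆ *A` is closed under all operations in `*𝒪`. -/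
def IsSubalgebra (B : Set (Star ρ A)) : Prop :=
  ∀ (o : I → 𝔸.Op) (x : ∀ i, 𝔸.arity (o i) → A),
    𝔸.entries ρ x ⊆ B → 𝔸.starOp ρ o x ∈ B

/-- `𝔸` is a subreduct of the subalgebra `B` of `*𝔸`: along `a ↦ *a`, the set `A` is contained in
`B`, and every operation `f ∈ 𝒪` of `𝔸` is the restriction of the operation `*f` of the standard
reduct of `B`. -/
def IsSubreduct (B : Set (Star ρ A)) : Prop :=
  (∀ a : A, (a : Star ρ A) ∈ B) ∧
    ∀ (f : 𝔸.Op) (x : 𝔸.arity f → A),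
      𝔸.starOp ρ (fun _ => f) (fun _ => x) = ((𝔸.op f x : A) : Star ρ A)

/-- `⟨X⟩`: the subalgebra of `*𝔸` generated by `X ⊆ *A`. -/
def gen (X : Set (Star ρ A)) : Set (Star ρ A) :=
  ⋂₀ {B | 𝔸.IsSubalgebra B ∧ X ⊆ B}

/-- `⟨X⟩^(int)`: the intersection of all internal subalgebras of `*𝔸` that contain `X ⊆ *A`. -/
def intGen (X : Set (Star ρ A)) : Set (Star ρ A) :=
  ⋂₀ {B | IsInternal B ∧ 𝔸.IsSubalgebra B ∧ X ⊆ B}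

/-- `B` is hyperfinitely generated: it is internally generated by a hyperfinite subset of `*A`. -/
def IsHyperfinitelyGenerated (B : Set (Star ρ A)) : Prop :=
  ∃ F : Set (Star ρ A), IsHyperfinite F ∧ B = 𝔸.intGen F

/-- The extension monad `Â` of `𝔸` in `*𝔸`. -/
def extensionMonad (ρ : Ultrafilter I) : Set (Star ρ A) :=
  ⋂₀ {B | IsInternal B ∧ 𝔸.IsSubalgebra B ∧ 𝔸.IsSubreduct B}

end Algebra

end Nonstandard

/-!
The subreduct condition holds for every subalgebra containing all standard points, so the extension
monad is the internal subalgebra generated by the standard points. Two facts carry the proof.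

* Transfer: the internal set `[Sᵢ]` is a subalgebra of `*𝔸` iff `Sᵢ` is a subalgebra of `𝔸` for
  almost every `i` (`isSubalgebra_members_iff`). Hence the internal subalgebra generated by an
  internal set `[Fᵢ]` is `[⟨Fᵢ⟩]`, which is again internal (`intGen_members`).
* Concurrency: if `Qᵢ ⊆ 𝒫(A)` and every finite `C ⊆ A` is contained in an internal set `[Sᵢ]` with
  `Sᵢ ∈ Qᵢ` almost everywhere, then a single such internal set contains all standard points
  (`InternalConcurrency.exists_internal_superset`).

Taking `Qᵢ` to be the finite subsets of `Sᵢ` puts, inside any internal subalgebra `[Sᵢ]` containing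
the standard points, a hyperfinite set that contains them too; this gives the first equality.
Taking `Qᵢ` to be the subalgebras of `𝔸` that omit `xᵢ` shows that a point `[xᵢ]` of the extension
monad already lies in `⟨F⟩^(int)` for some finite `F ⊆ A`
(`exists_finite_mem_intGen`), from which the other two equalities follow.
-/

namespace Nonstandard

open Filter

section Internal

variable {I : Type t} {ρ : Ultrafilter I} {X : Type u}

theorem coe_mem_members {x : I → X} {S : I → Set X} :
    (x : Star ρ X) ∈ members (S : Star ρ (Set X)) ↔ ∀ᶠ i in (ρ : Filter I), x i ∈ S i :=
  Iff.rfl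

theorem members_subset_members {S T : I → Set X} :
    members (S : Star ρ (Set X)) ⊆ members (T : Star ρ (Set X)) ↔
      ∀ᶠ i in (ρ : Filter I), S i ⊆ T i := by
  classical
  constructor
  · intro h
    by_contra hn
    rw [← Ultrafilter.eventually_not] at hn
    obtain ⟨j, hj⟩ := hn.exists
    obtain ⟨x₀, -, -⟩ := Set.not_subset.1 hj
    have key : ∀ i, ∃ x : X, ¬ S i ⊆ T i → x ∈ S i ∧ x ∉ T i := fun i => by
      by_cases hi : S i ⊆ T i
      · exact ⟨x₀, fun h => (h hi).elim⟩
      · obtain ⟨x, hx⟩ := Set.not_subset.1 hi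
        exact ⟨x, fun _ => hx⟩
    choose x hx using key
    have hxT := coe_mem_members.1 (h (coe_mem_members.2 (hn.mono fun i hi => (hx i hi).1)))
    obtain ⟨i, hi, hi'⟩ := (hn.and hxT).exists
    exact (hx i hi).2 hi'
  · rintro h ⟨x⟩ hx
    exact coe_mem_members.2 ((coe_mem_members.1 hx).mp (h.mono fun i hi hxi => hi hxi))

/-- A finite set acquires no new points under transfer. -/
theorem members_const_of_finite {F : Set X} (hF : F.Finite) :
    members (((fun _ => F : I → Set X)) : Star ρ (Set X)) =
      (fun a : X => (a : Star ρ X)) '' F := by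
  ext x
  constructor
  · induction x using Germ.inductionOn with | _ x => ?_
    intro hx
    obtain ⟨a, ha, hxa⟩ : ∃ a ∈ F, ∀ᶠ i in (ρ : Filter I), x i = a := by
      have h : (⋃ a ∈ F, {i | x i = a}) ∈ ρ :=
        Filter.mem_of_superset (coe_mem_members.1 hx) fun i hi => by simpa using hi
      exact (Ultrafilter.finite_biUnion_mem_iff hF).1 h
    exact ⟨a, ha, Germ.coe_eq.2 (hxa.mono fun i hi => hi.symm)⟩
  · rintro ⟨a, ha, rfl⟩
    exact coe_mem_members.2 (Eventually.of_forall fun _ => ha)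

theorem isHyperfinite_image_of_finite {F : Set X} (hF : F.Finite) :
    IsHyperfinite ((fun a : X => (a : Star ρ X)) '' F) :=
  ⟨((fun _ => F : I → Set X) : Star ρ (Set X)), Eventually.of_forall fun _ => hF,
    (members_const_of_finite hF).symm⟩

/-- Concurrency for the relation `a ∈ T ∈ Qᵢ` between points `a` and subsets `T` of `A`. -/
theorem InternalConcurrency.exists_internal_superset {A : Type u}
    (hρ : InternalConcurrency ρ A) (Q : I → Set (Set A))
    (h : ∀ C : Set A, C.Finite →
      ∃ S : I → Set A, ∀ᶠ i in (ρ : Filter I), S i ∈ Q i ∧ C ⊆ S i) :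
    ∃ S : I → Set A, (∀ᶠ i in (ρ : Filter I), S i ∈ Q i) ∧
      ∀ a : A, (a : Star ρ A) ∈ members (S : Star ρ (Set A)) := by
  -- Over an empty `A` the principle is void, but there the premise at `C = ∅` is enough.
  rcases isEmpty_or_nonempty A with hA | ⟨⟨a₀⟩⟩
  · obtain ⟨S, hS⟩ := h ∅ Set.finite_empty
    exact ⟨S, hS.mono fun i hi => hi.1, fun a => isEmptyElim a⟩
  let U : Set (SuperLevel A 0) := Set.univ
  let Y : Set (SuperLevel A 1) := Set.range (Sum.inr : Set A → A ⊕ Set A)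
  let R : I → Set (U × Y) := fun i =>
    {p | ∃ T ∈ Q i, (p.1.1 : A) ∈ T ∧ (p.2.1 : A ⊕ Set A) = Sum.inr T}
  obtain ⟨b, hb⟩ := hρ 0 1 U Y (R : Star ρ (Set (U × Y))) (by
    intro C hC
    obtain ⟨S, hS⟩ := h (Subtype.val '' C) (hC.image _)
    refine ⟨((fun i => ⟨Sum.inr (S i), S i, rfl⟩ : I → Y) : Star ρ Y), fun x hx => ?_⟩
    exact hS.mono fun i hi => ⟨S i, hi.1, hi.2 ⟨x, hx, rfl⟩, rfl⟩)
  induction b using Germ.inductionOn with | _ f => ?_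
  choose S hS using fun i => (f i).2
  have key : ∀ a : A, ∀ᶠ i in (ρ : Filter I), S i ∈ Q i ∧ a ∈ S i := fun a => by
    have hr : ∀ᶠ i in (ρ : Filter I), ((⟨a, trivial⟩ : U), f i) ∈ R i := hb ⟨a, trivial⟩
    refine hr.mono fun i hi => ?_
    obtain ⟨T, hTQ, haT, hT⟩ := hi
    obtain rfl : S i = T := Sum.inr_injective ((hS i).trans hT)
    exact ⟨hTQ, haT⟩
  exact ⟨S, (key a₀).mono fun i hi => hi.1, fun a =>
    coe_mem_members.2 ((key a).mono fun i hi => hi.2)⟩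

/-- Inside an internal set containing the standard points there is a hyperfinite set containing
them. -/
theorem InternalConcurrency.exists_isHyperfinite {A : Type u}
    (hρ : InternalConcurrency ρ A) {B : Set (Star ρ A)} (hB : IsInternal B)
    (h : ∀ a : A, (a : Star ρ A) ∈ B) :
    ∃ F : Set (Star ρ A), IsHyperfinite F ∧ F ⊆ B ∧ ∀ a : A, (a : Star ρ A) ∈ F := by
  obtain ⟨S, rfl⟩ := hB
  induction S using Germ.inductionOn with | _ S => ?_
  obtain ⟨T, hT, hAT⟩ := hρ.exists_internal_superset (fun i => {T | T.Finite ∧ T ⊆ S i})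
    fun C hC => ⟨fun _ => C, by
      have hCS : ∀ᶠ i in (ρ : Filter I), ∀ a ∈ C, a ∈ S i :=
        (eventually_all_finite hC).2 fun a _ => coe_mem_members.1 (h a)
      exact hCS.mono fun i hi => ⟨⟨hC, hi⟩, subset_rfl⟩⟩
  exact ⟨_, ⟨(T : Star ρ (Set A)), hT.mono fun i hi => hi.1, rfl⟩,
    members_subset_members.2 (hT.mono fun i hi => hi.2), hAT⟩

end Internal

namespace Algebra

variable {I : Type t} {ρ : Ultrafilter I} {A : Type u} (𝔸 : Algebra.{u, v, w} A)

/-- `T ≤ 𝔸`: the set `T ⊆ A` is closed under all operations of `𝔸`. -/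
def IsClosedSet (T : Set A) : Prop :=
  ∀ (o : 𝔸.Op) (x : 𝔸.arity o → A), Set.range x ⊆ T → 𝔸.op o x ∈ T

/-- The subalgebra of `𝔸` generated by `T ⊆ A`. -/
def closure (T : Set A) : Set A :=
  ⋂₀ {B | 𝔸.IsClosedSet B ∧ T ⊆ B}

theorem isClosedSet_closure (T : Set A) : 𝔸.IsClosedSet (𝔸.closure T) := fun o x hx B hB =>
  hB.1 o x fun _ ha => hx ha B hB

theorem subset_closure (T : Set A) : T ⊆ 𝔸.closure T := fun _ ha _ hB => hB.2 ha

/-- Transfer of the notion of subalgebra. -/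
theorem isSubalgebra_members_iff {S : I → Set A} :
    𝔸.IsSubalgebra (members (S : Star ρ (Set A))) ↔
      ∀ᶠ i in (ρ : Filter I), 𝔸.IsClosedSet (S i) := by
  constructor
  · intro h
    by_contra hn
    rw [← Ultrafilter.eventually_not] at hn
    -- One violation supplies an operation and a tuple at the indices where there is none.
    obtain ⟨j, hj⟩ := hn.exists
    have bad : ∀ T : Set A, ¬ 𝔸.IsClosedSet T →
        ∃ p : Σ o : 𝔸.Op, 𝔸.arity o → A, Set.range p.2 ⊆ T ∧ 𝔸.op p.1 p.2 ∉ T := by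
      intro T hT
      simp only [IsClosedSet, not_forall] at hT
      obtain ⟨o, x, hx, hox⟩ := hT
      exact ⟨⟨o, x⟩, hx, hox⟩
    obtain ⟨p₀, -⟩ := bad _ hj
    have key : ∀ i, ∃ p : Σ o : 𝔸.Op, 𝔸.arity o → A, ¬ 𝔸.IsClosedSet (S i) →
        Set.range p.2 ⊆ S i ∧ 𝔸.op p.1 p.2 ∉ S i := fun i => by
      by_cases hi : 𝔸.IsClosedSet (S i)
      · exact ⟨p₀, fun h => (h hi).elim⟩
      · obtain ⟨p, hp⟩ := bad _ hi
        exact ⟨p, fun _ => hp⟩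
    choose p hp using key
    have hmem := coe_mem_members.1 (h (fun i => (p i).1) (fun i => (p i).2)
      (members_subset_members.2 (hn.mono fun i hi => (hp i hi).1)))
    obtain ⟨i, hi, hi'⟩ := (hn.and hmem).exists
    exact (hp i hi).2 hi'
  · intro h o x hx
    exact coe_mem_members.2
      ((h.and (members_subset_members.1 hx)).mono fun i hi => hi.1 _ _ hi.2)

theorem isSubalgebra_intGen (X : Set (Star ρ A)) : 𝔸.IsSubalgebra (𝔸.intGen X) :=
  fun o x hx B hB => hB.2.1 o x fun _ ha => hx ha B hB

theorem subset_intGen (X : Set (Star ρ A)) : X ⊆ 𝔸.intGen X := fun _ hx _ hB => hB.2.2 hx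

theorem intGen_subset {X B : Set (Star ρ A)} (hB : IsInternal B) (hB' : 𝔸.IsSubalgebra B)
    (h : X ⊆ B) : 𝔸.intGen X ⊆ B :=
  Set.sInter_subset_of_mem ⟨hB, hB', h⟩

/-- The internal subalgebra generated by an internal set is computed indexwise. -/
theorem intGen_members (S : I → Set A) :
    𝔸.intGen (members (S : Star ρ (Set A))) =
      members ((fun i => 𝔸.closure (S i) : I → Set A) : Star ρ (Set A)) := by
  apply Set.Subset.antisymm
  · exact 𝔸.intGen_subset ⟨_, rfl⟩
      (𝔸.isSubalgebra_members_iff.2 (Eventually.of_forall fun i => 𝔸.isClosedSet_closure _))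
      (members_subset_members.2 (Eventually.of_forall fun i => 𝔸.subset_closure _))
  · rintro x hx B ⟨⟨T, rfl⟩, hT, hST⟩
    induction T using Germ.inductionOn with | _ T => ?_
    refine members_subset_members.2 ?_ hx
    filter_upwards [𝔸.isSubalgebra_members_iff.1 hT, members_subset_members.1 hST] with i h₁ h₂
    exact Set.sInter_subset_of_mem ⟨h₁, h₂⟩

theorem IsHyperfinitelyGenerated.isInternal {B : Set (Star ρ A)}
    (hB : 𝔸.IsHyperfinitelyGenerated B) : IsInternal B := by
  obtain ⟨_, ⟨S, -, rfl⟩, rfl⟩ := hB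
  induction S using Germ.inductionOn with | _ S => ?_
  exact ⟨_, 𝔸.intGen_members S⟩

theorem isSubreduct_iff {B : Set (Star ρ A)} :
    𝔸.IsSubreduct B ↔ ∀ a : A, (a : Star ρ A) ∈ B :=
  ⟨fun h => h.1, fun h => ⟨h, fun _ _ => rfl⟩⟩

theorem isSubalgebra_extensionMonad : 𝔸.IsSubalgebra (𝔸.extensionMonad ρ) :=
  fun o x hx B hB => hB.2.1 o x fun _ ha => hx ha B hB

theorem coe_mem_extensionMonad (a : A) : (a : Star ρ A) ∈ 𝔸.extensionMonad ρ :=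
  fun _ hB => hB.2.2.1 a

/-- Although the extension monad need not be internal, it contains the internal subalgebras
generated by its subsets, being an intersection of internal subalgebras. -/
theorem intGen_subset_extensionMonad {X : Set (Star ρ A)} (hX : X ⊆ 𝔸.extensionMonad ρ) :
    𝔸.intGen X ⊆ 𝔸.extensionMonad ρ := fun _ hx _ hB =>
  𝔸.intGen_subset hB.1 hB.2.1 (fun _ hy => hX hy _ hB) hx

/-- If a point lies outside `⟨F⟩^(int)` for every finite `F ⊆ A`, concurrency merges the internal
subalgebras omitting it into one that contains all standard points. -/
theorem exists_finite_mem_intGen (hρ : InternalConcurrency ρ A) {x : Star ρ A}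
    (hx : x ∈ 𝔸.extensionMonad ρ) :
    ∃ F : Set A, F.Finite ∧ x ∈ 𝔸.intGen ((fun a : A => (a : Star ρ A)) '' F) := by
  induction x using Germ.inductionOn with | _ x => ?_
  by_contra! hn
  obtain ⟨S, hS, hAS⟩ := hρ.exists_internal_superset
    (fun i => {T | 𝔸.IsClosedSet T ∧ x i ∉ T}) fun C hC => by
      refine ⟨fun i => 𝔸.closure C, ?_⟩
      have h := hn C hC
      rw [← members_const_of_finite hC, 𝔸.intGen_members, coe_mem_members,
        ← Ultrafilter.eventually_not] at h
      exact h.mono fun i hi => ⟨⟨𝔸.isClosedSet_closure C, hi⟩, 𝔸.subset_closure C⟩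
  have hxS := coe_mem_members.1 (hx _ ⟨⟨_, rfl⟩,
    𝔸.isSubalgebra_members_iff.2 (hS.mono fun i hi => hi.1), 𝔸.isSubreduct_iff.2 hAS⟩)
  obtain ⟨i, hi, hi'⟩ := (hS.and hxS).exists
  exact hi.2 hi'

end Algebra

end Nonstandard

theorem mainTheorem5 {I : Type t} (ρ : Ultrafilter I) {A : Type u}
    (hρ : Nonstandard.InternalConcurrency ρ A) (𝔸 : Nonstandard.Algebra.{u, v, w} A) :
    𝔸.extensionMonad ρ =
        ⋂₀ {B : Set (Nonstandard.Star ρ A) | Nonstandard.IsInternal B ∧ 𝔸.IsSubalgebra B ∧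
          𝔸.IsHyperfinitelyGenerated B ∧ 𝔸.IsSubreduct B} ∧
      𝔸.extensionMonad ρ =
        𝔸.gen (⋃ F ∈ {F : Set A | F.Finite}, 𝔸.intGen ((fun a : A => (a : Nonstandard.Star ρ A)) '' F)) ∧
      𝔸.extensionMonad ρ =
        ⋃ F ∈ {F : Set (Nonstandard.Star ρ A) | Nonstandard.IsHyperfinite F ∧
          F ⊆ 𝔸.extensionMonad ρ}, 𝔸.intGen F := by
  have himg : ∀ F : Set A, (fun a : A => (a : Nonstandard.Star ρ A)) '' F ⊆ 𝔸.extensionMonad ρ :=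
    fun F => Set.image_subset_iff.2 fun a _ => 𝔸.coe_mem_extensionMonad a
  refine ⟨Set.Subset.antisymm ?_ ?_, Set.Subset.antisymm ?_ ?_, Set.Subset.antisymm ?_ ?_⟩
  · exact fun x hx B hB => hx B ⟨hB.1, hB.2.1, hB.2.2.2⟩
  · rintro x hx B ⟨hB, hB', hAB⟩
    obtain ⟨F, hF, hFB, hAF⟩ := hρ.exists_isHyperfinite hB hAB.1
    have hgen : 𝔸.IsHyperfinitelyGenerated (𝔸.intGen F) := ⟨F, hF, rfl⟩
    exact 𝔸.intGen_subset hB hB' hFB (hx _ ⟨hgen.isInternal, 𝔸.isSubalgebra_intGen F, hgen,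
      𝔸.isSubreduct_iff.2 fun a => 𝔸.subset_intGen F (hAF a)⟩)
  · intro x hx B hB
    obtain ⟨F, hF, hxF⟩ := 𝔸.exists_finite_mem_intGen hρ hx
    exact hB.2 (Set.mem_biUnion hF hxF)
  · exact Set.sInter_subset_of_mem ⟨𝔸.isSubalgebra_extensionMonad,
      Set.iUnion₂_subset fun F _ => 𝔸.intGen_subset_extensionMonad (himg F)⟩
  · intro x hx
    obtain ⟨F, hF, hxF⟩ := 𝔸.exists_finite_mem_intGen hρ hx
    exact Set.mem_biUnion ⟨Nonstandard.isHyperfinite_image_of_finite hF, himg F⟩ hxF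
  · exact Set.iUnion₂_subset fun F hF => 𝔸.intGen_subset_extensionMonad hF.2
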